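/- **Setting.** For $\mathtt v\in\mathbb N$, let $\mathfrak L^{\mathtt v}$ be the set of linear differential behaviors $\mathfrak B=\{v\in C^\infty(\mathbb R,\mathbb R^{\mathtt v}) \mid R(\tfrac{d}{dt})v=0\}$, where $R$ is a real polynomial matrix with $\mathtt v$ columns and finitely many (at least one) rows. A set of components of $v$ is *free* in $\mathfrak B$ if these components can be prescribed as arbitrary smooth functions and completed to an element of $\mathfrak B$. An input-output partition $v=(u,y)$ of $\mathfrak B$ is a component-wise partition in which $u$ is maximally free. The output cardinality $\mathtt p(\mathfrak B)$ is the number of components of $y$ in such a partition; it does not depend on the partition. The subscript in $(\mathfrak B)_{v}$ denotes the manifest behavior with respect to $v$, i.e. the projection of $\mathfrak B$ onto the components $v$. All trajectories are smooth. Let $L\in\mathbb N$ and, for $i=1,\dots,L$, let $\mathcal P_i\in\mathfrak L^{\mathtt w_i+\mathtt s_i+\mathtt c_i}$ (plants, with trajectories $(w_i,s_i,c_i)$) and $\mathcal K_i\in\mathfrak L^{\mathtt w_i+\mathtt k_i}$ (desired behaviors, with trajectories $(w_i,k_i)$). The connection variables are partitioned as $s_i=(s_{ij})_{j\ne i}$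 and $k_i=(k_{ij})_{j\neq i}$, and shared: $s_{ij}=s_{ji}$, $k_{ij}=k_{ji}$. Let $w=(w_1,\dots,w_L)$, and similarly for $c,s,k$, and put $$\mathcal P_{\mathcal I}=\{(w,s,c)\mid (w_i,s_i,c_i)\in\mathcal P_i\ \forall i\},\qquad \mathcal K_{\mathcal I}=\{(w,k)\mid (w_i,k_i)\in\mathcal K_i\ \forall i\}.$$ A distributed controller consists of behaviors $\mathcal C_i\in\mathfrak L^{\mathtt c_i+\mathtt p_i}$, $i=1,\dots,L$, with trajectories $(c_i,p_i)$, $p_i=(p_{ij})_{j\ne i}$, shared variables $p_{ij}=p_{ji}$, such that for all $i\neq j$: if $s_{ij}$ has no components, then $p_{ij}$ has no components. Put $\mathcal C_{\mathcal I}=\{(c,p)\mid (c_i,p_i)\in\mathcal C_i\ \forall i\}$. It implements $\mathcal K_{\mathcal I}$ if $(\mathcal K_{\mathcal I})_w=(\mathcal P_{\mathcal I}\wedge_c\mathcal C_{\mathcal I})_w$, where $\mathcal P_{\mathcal I}\wedge_c\mathcal C_{\mathcal I}=\{(w,s,c,p)\mid (w,s,c)\in\mathcal P_{\mathcal I},\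 (c,p)\in\mathcal C_{\mathcal I}\}$. **Proposition.** Suppose that $(\mathcal P_{\mathcal I})_c=C^\infty(\mathbb R,\mathbb R^{\mathtt c})$, where $\mathtt c=\mathtt c_1+\dots+\mathtt c_L$. Then every distributed controller that implements $\mathcal K_{\mathcal I}$ is regular with respect to $c$, i.e. $$\mathtt p\big((\mathcal P_{\mathcal I})_{(w,c)}\big)+\mathtt p\big((\mathcal C_{\mathcal I})_c\big)=\mathtt p\big((\mathcal P_{\mathcal I})_{(w,c)}\wedge_c(\mathcal C_{\mathcal I})_c\big),$$ where $(\mathcal P_{\mathcal I})_{(w,c)}\wedge_c(\mathcal C_{\mathcal I})_c=\{(w,c)\in(\mathcal P_{\mathcal I})_{(w,c)}\mid c\in(\mathcal C_{\mathcal I})_c\}$. -/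

import Mathlib

open scoped ContDiff Polynomial

noncomputable section

namespace Behavioral

/-! ### Smooth trajectories and polynomial differential operators -/

/-- The real vector space `C^∞(ℝ, ℝ)`. -/
def Smooth : Submodule ℝ (ℝ → ℝ) where
  carrier := {f | ContDiff ℝ ∞ f}
  add_mem' {f g} (hf : ContDiff ℝ ∞ f) (hg : ContDiff ℝ ∞ g) :=
    (hf.add hg : ContDiff ℝ ∞ (f + g))
  zero_mem' := (contDiff_const : ContDiff ℝ ∞ (fun _ : ℝ => (0 : ℝ)))
  smul_mem' a f (hf : ContDiff ℝ ∞ f) := (hf.const_smul a : ContDiff ℝ ∞ (a • f))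

/-- The differentiation operator `d/dt` on `C^∞(ℝ, ℝ)`. -/
def ddt : Module.End ℝ Smooth where
  toFun f := ⟨deriv f.1, (contDiff_infty_iff_deriv.1 f.2).2⟩
  map_add' f g := by
    ext t
    exact deriv_add ((contDiff_infty_iff_deriv.1 f.2).1 t) ((contDiff_infty_iff_deriv.1 g.2).1 t)
  map_smul' a f := by
    ext t
    exact deriv_const_smul a ((contDiff_infty_iff_deriv.1 f.2).1 t)

/-- Smooth trajectories whose components are labelled by `ι`, that is, `C^∞(ℝ, ℝ^ι)`
(given by its smooth components). -/
abbrev Traj (ι : Type) : Type := ι → Smooth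

/-- A behavior with variables labelled by `ι`: a set of smooth trajectories. -/
abbrev Behavior (ι : Type) : Type := Set (Traj ι)

/-- The vector `R(d/dt) w`. -/
def applyOp {g : ℕ} {ι : Type} [Fintype ι] (R : Matrix (Fin g) ι ℝ[X]) (w : Traj ι) :
    Fin g → Smooth :=
  fun r => ∑ j, (Polynomial.aeval ddt (R r j)) (w j)

/-- The class `𝔏^ι` of linear differential behaviors: the solution sets
`{w | R(d/dt) w = 0}`, where `R` is a real polynomial matrix with `g > 0` rows. -/
def LinDiff (ι : Type) [Fintype ι] : Set (Behavior ι) :=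
  {B | ∃ (g : ℕ) (_ : 0 < g) (R : Matrix (Fin g) ι ℝ[X]), B = {w | applyOp R w = 0}}

/-! ### Inputs and outputs -/

/-- The components labelled by `S` are free in `B`: they can be prescribed arbitrarily. -/
def IsFree {ι : Type} (B : Behavior ι) (S : Finset ι) : Prop :=
  ∀ u : Traj ι, ∃ x ∈ B, ∀ j ∈ S, x j = u j

/-- `S` is the set of input components of an input-output partition of `B`:
the components in `S` are maximally free. -/
def IsInputSet {ι : Type} (B : Behavior ι) (S : Finset ι) : Prop :=
  Maximal (IsFree B) S

/-- The output cardinality `p(B)`: the number of output components in an input-output partition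
of `B`. For a linear differential behavior this number is the same for all partitions;
formally the least one is taken. -/
def outputCard {ι : Type} [Fintype ι] [DecidableEq ι] (B : Behavior ι) : ℕ :=
  sInf {p | ∃ S : Finset ι, IsInputSet B S ∧ Sᶜ.card = p}

/-! ### Elimination and interconnection of two behaviors -/

/-- The manifest behavior of `B` with respect to the components selected by `f : κ → ι`; the other
components are eliminated. -/
def manifest {ι κ : Type} (f : κ → ι) (B : Behavior ι) : Behavior κ :=
  {y | ∃ x ∈ B, ∀ k, y k = x (f k)}

/-- The interconnection `B₁ ∧_β B₂ = {(a, b, c) | (a, b) ∈ B₁ and (b, c) ∈ B₂}`. -/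
def interconnect {α β γ : Type} (B₁ : Behavior (α ⊕ β)) (B₂ : Behavior (β ⊕ γ)) :
    Behavior (α ⊕ (β ⊕ γ)) :=
  {x | (fun v => x (Sum.map id Sum.inl v)) ∈ B₁ ∧ (fun v => x (Sum.inr v)) ∈ B₂}

/-- The controlled interconnection `P ∧_c C = {(w, c) ∈ P | c ∈ C}`. -/
def controlled {α γ : Type} (P : Behavior (α ⊕ γ)) (C : Behavior γ) : Behavior (α ⊕ γ) :=
  {x | x ∈ P ∧ (fun v => x (Sum.inr v)) ∈ C}

/-- The interconnection of `P` and `C` through `c` is regular. -/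
def IsRegular {α γ : Type} [Fintype α] [Fintype γ] [DecidableEq α] [DecidableEq γ]
    (P : Behavior (α ⊕ γ)) (C : Behavior γ) : Prop :=
  outputCard P + outputCard C = outputCard (controlled P C)

/-! ### Networks of `L` behaviors

For `i ≠ j` the `i`-th and the `j`-th subsystem share one variable `s_ij = s_ji`. It is labelled by
the unordered pair `{i, j}`, so that the symmetry of the sharing is built in. -/

/-- Unordered pairs of distinct subsystems. -/
abbrev Pair (L : ℕ) : Type := {e : Sym2 (Fin L) // ¬ e.IsDiag}

/-- The pair `{i, j}`, for `j ≠ i`. -/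
def pair {L : ℕ} (i : Fin L) (j : {j : Fin L // j ≠ i}) : Pair L :=
  ⟨s(i, j.1), fun h => j.2 (Sym2.mk_isDiag_iff.1 h).symm⟩

/-- The components of `(v_1, …, v_L)`, where `v_i` has `d i` components. -/
abbrev Stack {L : ℕ} (d : Fin L → ℕ) : Type := Σ i : Fin L, Fin (d i)

/-- The components of all connection variables, where `s_ij` has `σ {i, j}` components. -/
abbrev Conn {L : ℕ} (σ : Pair L → ℕ) : Type := Σ e : Pair L, Fin (σ e)

/-- The components of the local connection variable `s_i = (s_ij)_{j ≠ i}`. -/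
abbrev LocalConn {L : ℕ} (σ : Pair L → ℕ) (i : Fin L) : Type :=
  Σ j : {j : Fin L // j ≠ i}, Fin (σ (pair i j))

/-- The component of all connection variables to which a component of `s_i` is identified. -/
def connOfLocal {L : ℕ} (σ : Pair L → ℕ) (i : Fin L) (v : LocalConn σ i) : Conn σ :=
  ⟨pair i v.1, v.2⟩

/-- The interconnected plant `P_I = {(w, s, c) | (w_i, s_i, c_i) ∈ P_i for all i}`. -/
def plantNetwork {L : ℕ} {w c : Fin L → ℕ} {s : Pair L → ℕ}
    (P : ∀ i, Behavior ((Fin (w i) ⊕ LocalConn s i) ⊕ Fin (c i))) :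
    Behavior ((Stack w ⊕ Conn s) ⊕ Stack c) :=
  {x | ∀ i, (fun v => x (Sum.map (Sum.map (Sigma.mk i) (connOfLocal s i)) (Sigma.mk i) v)) ∈ P i}

/-- The interconnection `{(v, k) | (v_i, k_i) ∈ B_i for all i}` of behaviors with external
variables `v_i` through connection variables `k_i`. It is used for the desired behavior `K_I`,
with `(v, k) = (w, k)`, and for the distributed controller `C_I`, with `(v, k) = (c, p)`. -/
def network {L : ℕ} {d : Fin L → ℕ} {k : Pair L → ℕ}
    (B : ∀ i, Behavior (Fin (d i) ⊕ LocalConn k i)) : Behavior (Stack d ⊕ Conn k) :=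
  {x | ∀ i, (fun v => x (Sum.map (Sigma.mk i) (connOfLocal k i) v)) ∈ B i}

/-- The controller structure respects the plant structure: subsystems that share no variable in the
plant (`s_ij` has no components) share none in the controller. -/
def IsDistributed {L : ℕ} (s p : Pair L → ℕ) : Prop :=
  ∀ e, s e = 0 → p e = 0

/-- The controllers `C_i` implement `K_I`: `(K_I)_w = (P_I ∧_c C_I)_w`. -/
def Implements {L : ℕ} {w c : Fin L → ℕ} {s p k : Pair L → ℕ}
    (P : ∀ i, Behavior ((Fin (w i) ⊕ LocalConn s i) ⊕ Fin (c i)))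
    (K : ∀ i, Behavior (Fin (w i) ⊕ LocalConn k i))
    (C : ∀ i, Behavior (Fin (c i) ⊕ LocalConn p i)) : Prop :=
  manifest Sum.inl (network K) =
    manifest (fun v => Sum.inl (Sum.inl v)) (interconnect (plantNetwork P) (network C))

end Behavioral

end

/-! Let `ℝ[X]` act on smooth functions through `d/dt`. Nonzero polynomials act surjectively, so over
this PID `Smooth` is an injective module (`baer_smooth`). Behaviors can then be studied through the
modules of rows annihilating them. A set of components is free in a manifest behavior iff no nonzero
annihilating row is supported on it (`IsFree.isIndepMod`, `IsKernel.isFree_manifest`), so the output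
cardinality is the rank of the annihilator (`IsKernel.outputCard_manifest`).

Since `c` is free in the plant, no nonzero plant row involves only `c`. Hence plant rows and
controller rows together form a direct sum inside the annihilator of the controlled behavior, which
bounds its output cardinality below by the sum of the two ranks (`finrank_annihilator_controlled`).
The bound is attained: extend `c` to a maximal input set of the plant and remove the outputs of the
controller; the rest is free (`isRegular_of_manifest_eq_univ`). -/

namespace Behavioral

open Polynomial Module

/-! ### `C^∞(ℝ, ℝ)` as a module over the polynomial differential operators -/

/-- Polynomials act on smooth functions as differential operators: `p • f = p(d/dt) f`. -/
noncomputable instance : Module ℝ[X] Smooth :=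
  Module.compHom Smooth (Polynomial.aeval ddt : ℝ[X] →ₐ[ℝ] Module.End ℝ Smooth).toRingHom

theorem aeval_ddt_apply (p : ℝ[X]) (f : Smooth) : aeval ddt p f = p • f := rfl

theorem C_smul (a : ℝ) (f : Smooth) : (C a : ℝ[X]) • f = a • f := by
  rw [← aeval_ddt_apply, aeval_C, Module.algebraMap_end_apply]

theorem X_smul (f : Smooth) : (X : ℝ[X]) • f = ddt f := by
  rw [← aeval_ddt_apply, aeval_X]

theorem hasDerivAt_ddt (f : Smooth) (t : ℝ) : HasDerivAt f.1 ((ddt f).1 t) t :=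
  ((contDiff_infty_iff_deriv.1 f.2).1 t).hasDerivAt

theorem ddt_eq_of_hasDerivAt {f g : Smooth} (h : ∀ t, HasDerivAt f.1 (g.1 t) t) : ddt f = g := by
  ext t
  exact (h t).deriv

theorem exists_ddt_eq (f : Smooth) : ∃ F : Smooth, ddt F = f := by
  have hc : Continuous f.1 := (show ContDiff ℝ ∞ f.1 from f.2).continuous
  have hd : ∀ t, HasDerivAt (fun u => ∫ x in (0 : ℝ)..u, f.1 x) (f.1 t) t := fun t =>
    (hc.integral_hasStrictDerivAt 0 t).hasDerivAt
  have hF : ContDiff ℝ ∞ (fun u => ∫ x in (0 : ℝ)..u, f.1 x) := by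
    refine contDiff_infty_iff_deriv.2 ⟨fun t => (hd t).differentiableAt, ?_⟩
    rw [show deriv (fun u => ∫ x in (0 : ℝ)..u, f.1 x) = f.1 from funext fun t => (hd t).deriv]
    exact f.2
  exact ⟨⟨_, hF⟩, ddt_eq_of_hasDerivAt hd⟩

/-- Variation of constants: `y(t) = e^{at} ∫₀ᵗ e^{-ax} f(x) dx`, up to a constant of integration. -/
theorem linear_smul_surjective (a : ℝ) (f : Smooth) : ∃ y : Smooth, (X - C a : ℝ[X]) • y = f := by
  have hf : ContDiff ℝ ∞ f.1 := f.2
  obtain ⟨G, hG⟩ := exists_ddt_eq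
    ⟨fun t => Real.exp (-(a * t)) * f.1 t, show ContDiff ℝ ∞ _ by fun_prop⟩
  have hGs : ContDiff ℝ ∞ G.1 := G.2
  let y : Smooth := ⟨fun t => Real.exp (a * t) * G.1 t, show ContDiff ℝ ∞ _ by fun_prop⟩
  refine ⟨y, ?_⟩
  have hy : ddt y = a • y + f := by
    refine ddt_eq_of_hasDerivAt fun t => ?_
    have hG' := hasDerivAt_ddt G t
    rw [hG] at hG'
    have he : HasDerivAt (fun t => Real.exp (a * t)) (Real.exp (a * t) * (a * 1)) t :=
      ((hasDerivAt_id t).const_mul a).exp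
    refine (he.mul hG').congr_deriv ?_
    change _ = a * (Real.exp (a * t) * G.1 t) + f.1 t
    have h1 : Real.exp (a * t) * Real.exp (-(a * t)) = 1 := by
      rw [← Real.exp_add, add_neg_cancel, Real.exp_zero]
    linear_combination f.1 t * h1
  rw [sub_smul, X_smul, C_smul, hy, add_sub_cancel_left]

theorem quadratic_smul_surjective (a : ℝ) {b : ℝ} (hb : b ≠ 0) (f : Smooth) :
    ∃ y : Smooth, ((X - C a) ^ 2 + C b ^ 2 : ℝ[X]) • y = f := by
  have hf : ContDiff ℝ ∞ f.1 := f.2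
  obtain ⟨G, hG⟩ := exists_ddt_eq
    ⟨fun t => Real.exp (-(a * t)) * Real.cos (b * t) * f.1 t, show ContDiff ℝ ∞ _ by fun_prop⟩
  obtain ⟨H, hH⟩ := exists_ddt_eq
    ⟨fun t => Real.exp (-(a * t)) * Real.sin (b * t) * f.1 t, show ContDiff ℝ ∞ _ by fun_prop⟩
  have hGs : ContDiff ℝ ∞ G.1 := G.2
  have hHs : ContDiff ℝ ∞ H.1 := H.2
  -- `v + i u = e^{(a+ib)t} (G - i H)` is variation of constants for the complex root `a + ib`, so
  -- it solves `z' = (a + ib) z + f`. Eliminating `v` gives `((d/dt - a)² + b²) u = b f`.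
  let u : Smooth := ⟨fun t => Real.exp (a * t) *
    (Real.sin (b * t) * G.1 t - Real.cos (b * t) * H.1 t), show ContDiff ℝ ∞ _ by fun_prop⟩
  let v : Smooth := ⟨fun t => Real.exp (a * t) *
    (Real.cos (b * t) * G.1 t + Real.sin (b * t) * H.1 t), show ContDiff ℝ ∞ _ by fun_prop⟩
  have he (t : ℝ) : HasDerivAt (fun t => Real.exp (a * t)) (Real.exp (a * t) * (a * 1)) t :=
    ((hasDerivAt_id t).const_mul a).exp
  have hs (t : ℝ) : HasDerivAt (fun t => Real.sin (b * t)) (Real.cos (b * t) * (b * 1)) t :=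
    ((hasDerivAt_id t).const_mul b).sin
  have hc (t : ℝ) : HasDerivAt (fun t => Real.cos (b * t)) (-Real.sin (b * t) * (b * 1)) t :=
    ((hasDerivAt_id t).const_mul b).cos
  have h1 (t : ℝ) : Real.exp (a * t) * Real.exp (-(a * t)) = 1 := by
    rw [← Real.exp_add, add_neg_cancel, Real.exp_zero]
  have hu : ddt u = a • u + b • v := by
    refine ddt_eq_of_hasDerivAt fun t => ?_
    have hG' := hasDerivAt_ddt G t
    have hH' := hasDerivAt_ddt H t
    rw [hG] at hG'
    rw [hH] at hH'
    refine ((he t).mul (((hs t).mul hG').sub ((hc t).mul hH'))).congr_deriv ?_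
    change _ = a * (Real.exp (a * t) * (Real.sin (b * t) * G.1 t - Real.cos (b * t) * H.1 t)) +
      b * (Real.exp (a * t) * (Real.cos (b * t) * G.1 t + Real.sin (b * t) * H.1 t))
    simp only [Pi.sub_apply, Pi.mul_apply]
    ring
  have hv : ddt v = a • v - b • u + f := by
    refine ddt_eq_of_hasDerivAt fun t => ?_
    have hG' := hasDerivAt_ddt G t
    have hH' := hasDerivAt_ddt H t
    rw [hG] at hG'
    rw [hH] at hH'
    refine ((he t).mul (((hc t).mul hG').add ((hs t).mul hH'))).congr_deriv ?_
    change _ = a * (Real.exp (a * t) * (Real.cos (b * t) * G.1 t + Real.sin (b * t) * H.1 t)) -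
      b * (Real.exp (a * t) * (Real.sin (b * t) * G.1 t - Real.cos (b * t) * H.1 t)) + f.1 t
    simp only [Pi.add_apply, Pi.mul_apply]
    linear_combination f.1 t * h1 t + Real.exp (a * t) * Real.exp (-(a * t)) * f.1 t *
      Real.sin_sq_add_cos_sq (b * t)
  have hu' : (X - C a : ℝ[X]) • u = (C b : ℝ[X]) • v := by
    rw [sub_smul, X_smul, C_smul, C_smul, hu, add_sub_cancel_left]
  have hv' : (X - C a : ℝ[X]) • v = f - (C b : ℝ[X]) • u := by
    rw [sub_smul, X_smul, C_smul, C_smul, hv]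
    abel
  have key : ((X - C a) ^ 2 + C b ^ 2 : ℝ[X]) • u = (C b : ℝ[X]) • f := by
    rw [add_smul, pow_two, mul_smul, hu', smul_comm, hv', smul_sub, pow_two, mul_smul,
      sub_add_cancel]
  refine ⟨(C b⁻¹ : ℝ[X]) • u, ?_⟩
  rw [smul_comm, key, smul_smul, ← C_mul, inv_mul_cancel₀ hb, C_1, one_smul]

/-- Peel off a real factor of degree one or two belonging to a complex root, and induct on the
degree. -/
theorem smul_surjective {p : ℝ[X]} (hp : p ≠ 0) (f : Smooth) : ∃ y : Smooth, p • y = f := by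
  induction hn : p.natDegree using Nat.strong_induction_on generalizing p f with
  | _ n ih =>
  have step {q : ℝ[X]} (hq : 0 < q.natDegree) (hdvd : q ∣ p)
      (hsurj : ∀ f : Smooth, ∃ y : Smooth, q • y = f) : ∃ y : Smooth, p • y = f := by
    obtain ⟨r, rfl⟩ := hdvd
    have hq0 := left_ne_zero_of_mul hp
    have hr0 := right_ne_zero_of_mul hp
    rw [natDegree_mul hq0 hr0] at hn
    obtain ⟨g, hg⟩ := hsurj f
    obtain ⟨y, hy⟩ := ih r.natDegree (by omega) hr0 g rfl
    exact ⟨y, by rw [mul_smul, hy, hg]⟩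
  rcases Nat.eq_zero_or_pos p.natDegree with h0 | hpos
  · obtain ⟨a, rfl⟩ := natDegree_eq_zero.1 h0
    have ha : a ≠ 0 := by
      rintro rfl
      simp at hp
    exact ⟨(C a⁻¹ : ℝ[X]) • f, by rw [smul_smul, ← C_mul, mul_inv_cancel₀ ha, C_1, one_smul]⟩
  · obtain ⟨z, hz⟩ := IsAlgClosed.exists_aeval_eq_zero ℂ p
      (natDegree_pos_iff_degree_pos.1 hpos).ne'
    by_cases him : z.im = 0
    · refine step (q := X - C z.re) (by simp) ?_ (linear_smul_surjective _)
      rw [dvd_iff_isRoot, IsRoot.def]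
      have hzr : z = algebraMap ℝ ℂ z.re := Complex.ext rfl (by simpa using him)
      rw [hzr, aeval_algebraMap_apply, coe_aeval_eq_eval] at hz
      simpa using hz
    · have hq : (X ^ 2 - C (2 * z.re) * X + C (‖z‖ ^ 2) : ℝ[X]) =
          (X - C z.re) ^ 2 + C z.im ^ 2 := by
        rw [Complex.sq_norm, Complex.normSq_apply]
        simp only [C_mul, C_add, C_ofNat]
        ring
      have hdvd := quadratic_dvd_of_aeval_eq_zero_im_ne_zero p hz him
      rw [hq] at hdvd
      refine step ?_ hdvd (quadratic_smul_surjective _ him)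
      rw [← C_pow, natDegree_add_C, natDegree_pow, natDegree_X_sub_C]
      norm_num

/-- `C^∞(ℝ, ℝ)` is an injective module over the polynomial differential operators. -/
theorem baer_smooth : Module.Baer ℝ[X] Smooth := by
  intro I g
  obtain ⟨a, rfl⟩ := (IsPrincipalIdealRing.principal I).principal
  by_cases ha : a = 0
  · refine ⟨0, fun x hx => ?_⟩
    have : (⟨x, hx⟩ : Submodule.span ℝ[X] {a}) = 0 := by
      subst ha
      exact Subtype.ext (by simpa using hx)
    rw [this, map_zero, LinearMap.zero_apply]
  · have hmem : a ∈ Submodule.span ℝ[X] {a} := Submodule.mem_span_singleton_self a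
    -- The ideal is principal, so extending `g` amounts to dividing `g a` by the generator `a`.
    obtain ⟨y, hy⟩ := smul_surjective ha (g ⟨a, hmem⟩)
    refine ⟨LinearMap.toSpanSingleton ℝ[X] Smooth y, fun x hx => ?_⟩
    obtain ⟨r, rfl⟩ := Submodule.mem_span_singleton.1 hx
    change (r * a) • y = _
    rw [mul_smul, hy, ← map_smul]
    rfl

/-! ### Annihilators of behaviors -/

section Annihilator

variable {ι κ : Type} [Fintype κ]

/-- Relabelling of polynomial rows along a map of labels. -/
noncomputable def relabel [DecidableEq ι] (f : κ → ι) : (κ → ℝ[X]) →ₗ[ℝ[X]] (ι → ℝ[X]) :=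
  Fintype.linearCombination ℝ[X] fun k => Pi.single (f k) 1

theorem relabel_apply [DecidableEq ι] {f : κ → ι} (hf : f.Injective) (r : κ → ℝ[X]) (k : κ) :
    relabel f r (f k) = r k := by
  classical
  simp [relabel, Fintype.linearCombination_apply, Pi.single_apply, hf.eq_iff]

theorem relabel_apply_of_notMem_range [DecidableEq ι] {f : κ → ι} (r : κ → ℝ[X]) {j : ι}
    (hj : j ∉ Set.range f) : relabel f r j = 0 := by
  have (k : κ) : j ≠ f k := fun h => hj ⟨k, h.symm⟩
  simp [relabel, Fintype.linearCombination_apply, this]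

variable [Fintype ι]

theorem linearCombination_relabel [DecidableEq ι] {M : Type*} [AddCommGroup M] [Module ℝ[X] M]
    (f : κ → ι) (x : ι → M) (r : κ → ℝ[X]) :
    Fintype.linearCombination ℝ[X] x (relabel f r) =
      Fintype.linearCombination ℝ[X] (x ∘ f) r := by
  have hr : relabel f r = ∑ k, r k • Pi.single (f k) 1 := Fintype.linearCombination_apply ..
  rw [hr, map_sum, Fintype.linearCombination_apply]
  refine Finset.sum_congr rfl fun k _ => ?_
  rw [map_smul, Fintype.linearCombination_apply_single, one_smul, Function.comp_apply]

/-- The module of all polynomial rows `r` with `r(d/dt) x = 0` for all `x ∈ B`. -/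
noncomputable def annihilator (B : Behavior ι) : Submodule ℝ[X] (ι → ℝ[X]) :=
  ⨅ x ∈ B, LinearMap.ker (Fintype.linearCombination ℝ[X] x)

theorem mem_annihilator {B : Behavior ι} {r : ι → ℝ[X]} :
    r ∈ annihilator B ↔ ∀ x ∈ B, Fintype.linearCombination ℝ[X] x r = 0 := by
  simp [annihilator]

/-- The behavior is determined by its annihilator. -/
def IsKernel (B : Behavior ι) : Prop :=
  ∀ x, (∀ r ∈ annihilator B, Fintype.linearCombination ℝ[X] x r = 0) → x ∈ B

/-- The defining rows of each `B i`, relabelled along `f i`, annihilate the whole set and already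
cut it out. Both kinds of network are of this form. -/
theorem isKernel_pullback {n : Type} {τ : n → Type} [∀ i, Fintype (τ i)] (f : ∀ i, τ i → ι)
    {B : ∀ i, Behavior (τ i)} (hB : ∀ i, B i ∈ LinDiff (τ i)) :
    IsKernel {x : Traj ι | ∀ i, (fun v => x (f i v)) ∈ B i} := by
  classical
  intro x hx i
  obtain ⟨g, -, R, hR⟩ := hB i
  rw [hR]
  funext a
  have ha : relabel (f i) (R a) ∈ annihilator {x : Traj ι | ∀ i, (fun v => x (f i v)) ∈ B i} := by
    refine mem_annihilator.2 fun y hy => ?_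
    rw [linearCombination_relabel]
    have hyi := hy i
    rw [hR] at hyi
    exact congrFun hyi a
  have h := hx _ ha
  rw [linearCombination_relabel] at h
  exact h

/-- No nonzero element of `N` is supported on `S`. -/
def IsIndepMod (N : Submodule ℝ[X] (ι → ℝ[X])) (S : Finset ι) : Prop :=
  ∀ r ∈ N, (∀ j ∉ S, r j = 0) → r = 0

/-- Forgetting the coordinates in `S` is injective on `N`. -/
theorem IsIndepMod.card_add_finrank_le {N : Submodule ℝ[X] (ι → ℝ[X])} {S : Finset ι}
    (h : IsIndepMod N S) : S.card + finrank ℝ[X] N ≤ Fintype.card ι := by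
  classical
  let φ : N →ₗ[ℝ[X]] ((Sᶜ : Finset ι) → ℝ[X]) :=
    (LinearMap.funLeft ℝ[X] ℝ[X] Subtype.val).comp N.subtype
  have hφ : Function.Injective φ := by
    refine (injective_iff_map_eq_zero φ).2 fun r hr => Subtype.ext (h r r.2 fun j hj => ?_)
    exact congrFun hr ⟨j, Finset.mem_compl.2 hj⟩
  have := LinearMap.finrank_le_finrank_of_injective hφ
  rw [finrank_fintype_fun_eq_card, Fintype.card_coe, Finset.card_compl] at this
  have := Finset.card_le_univ S
  omega

theorem IsIndepMod.exists_card_add_finrank_eq {N : Submodule ℝ[X] (ι → ℝ[X])} {S₀ : Finset ι}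
    (h₀ : IsIndepMod N S₀) :
    ∃ S, S₀ ⊆ S ∧ IsIndepMod N S ∧ S.card + finrank ℝ[X] N = Fintype.card ι := by
  classical
  obtain ⟨S, hS₀, hS⟩ := (Set.toFinite {S : Finset ι | IsIndepMod N S}).exists_le_maximal h₀
  refine ⟨S, hS₀, hS.prop, le_antisymm hS.prop.card_add_finrank_le ?_⟩
  -- By maximality of `S`, each `j` outside it has a row of `N` whose only nonzero entry off `S` is
  -- at `j`. These rows are diagonal on `Sᶜ`, hence independent.
  have hex (j : (Sᶜ : Finset ι)) : ∃ r ∈ N, (∀ i ∉ S, i ≠ j → r i = 0) ∧ r j ≠ 0 := by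
    have hj : j.1 ∉ S := Finset.mem_compl.1 j.2
    have hnot : ¬ IsIndepMod N (insert j.1 S) := fun hc =>
      hj (hS.le_of_ge hc (Finset.subset_insert _ _) (Finset.mem_insert_self _ _))
    simp only [IsIndepMod, not_forall] at hnot
    obtain ⟨r, hr, hsupp, hr0⟩ := hnot
    have hsupp' : ∀ i ∉ S, i ≠ j → r i = 0 := fun i hi hij => hsupp i (by simp [hi, hij])
    refine ⟨r, hr, hsupp', fun hrj => hr0 (hS.prop r hr fun i hi => ?_)⟩
    by_cases hij : i = j
    · rw [hij, hrj]
    · exact hsupp' i hi hij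
  choose r hrN hr0 hrj using hex
  have hli : LinearIndependent ℝ[X] fun j : (Sᶜ : Finset ι) => (⟨r j, hrN j⟩ : N) := by
    rw [Fintype.linearIndependent_iff]
    intro a ha j
    have hj := congrFun (congrArg Subtype.val ha) j.1
    rw [AddSubmonoidClass.coe_finsetSum, Finset.sum_apply, Finset.sum_eq_single j] at hj
    · exact (mul_eq_zero.1 hj).resolve_right (hrj j)
    · intro i _ hij
      change a i * r i j = 0
      rw [hr0 i j (Finset.mem_compl.1 j.2) fun h => hij (Subtype.ext h.symm), mul_zero]
    · exact fun h => absurd (Finset.mem_univ j) h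
  have := hli.fintype_card_le_finrank
  rw [Fintype.card_coe, Finset.card_compl] at this
  omega

theorem IsFree.isIndepMod {B : Behavior ι} {S : Finset ι} (h : IsFree B S) :
    IsIndepMod (annihilator B) S := by
  classical
  intro r hr hsupp
  by_contra hne
  obtain ⟨j, hj⟩ := Function.ne_iff.1 hne
  -- Prescribing `f` at `j` and zero elsewhere on `S` turns the equation of `r` into `1 = 0`.
  obtain ⟨f, hf⟩ := smul_surjective hj ⟨fun _ => 1, show ContDiff ℝ ∞ _ from contDiff_const⟩
  have hjS : j ∈ S := by
    by_contra hjS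
    exact hj (hsupp j hjS)
  obtain ⟨x, hx, hxS⟩ := h (Pi.single j f)
  have h0 := mem_annihilator.1 hr x hx
  rw [Fintype.linearCombination_apply, Finset.sum_eq_single j, hxS j hjS, Pi.single_eq_same,
    hf] at h0
  · exact one_ne_zero (congrFun (congrArg Subtype.val h0) 0)
  · intro i _ hij
    by_cases hi : i ∈ S
    · rw [hxS i hi, Pi.single_eq_of_ne hij, smul_zero]
    · rw [hsupp i hi, zero_smul]
  · exact fun h => absurd (Finset.mem_univ j) h

/-- Trajectories of `B` are the linear maps from the quotient of `ι → ℝ[X]` by `annihilator B` to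
`Smooth`. Independence embeds `S → ℝ[X]` in this quotient, and injectivity of `Smooth` extends the
prescribed `u` to such a map. -/
theorem IsKernel.isFree_manifest {B : Behavior ι} (hB : IsKernel B) (f : κ → ι) {S : Finset κ}
    (hS : IsIndepMod (annihilator (manifest f B)) S) : IsFree (manifest f B) S := by
  classical
  intro u
  let φ : (S → ℝ[X]) →ₗ[ℝ[X]] (ι → ℝ[X]) ⧸ annihilator B :=
    (annihilator B).mkQ.comp (relabel fun k : S => f k)
  have hφ : Function.Injective φ := by
    refine (injective_iff_map_eq_zero φ).2 fun r hr => ?_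
    have hr' := mem_annihilator.1 ((Submodule.Quotient.mk_eq_zero _).1 hr)
    have h0 := hS (relabel Subtype.val r) ?_ fun j hj =>
      relabel_apply_of_notMem_range r (by simpa using hj)
    · funext k
      rw [← relabel_apply Subtype.val_injective r k, h0]
      rfl
    · refine mem_annihilator.2 fun y ⟨x, hx, hy⟩ => ?_
      have h := hr' x hx
      rw [linearCombination_relabel] at h ⊢
      rw [show y = x ∘ f from funext hy]
      exact h
  obtain ⟨h, hh⟩ := baer_smooth.extension_property φ hφ
    (Fintype.linearCombination ℝ[X] fun k : S => u k)
  let x : Traj ι := fun j => h ((annihilator B).mkQ (Pi.single j 1))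
  have hx : Fintype.linearCombination ℝ[X] x = h.comp (annihilator B).mkQ := by
    refine LinearMap.pi_ext' fun j => LinearMap.ext_ring ?_
    simp [x, Fintype.linearCombination_apply_single]
  refine ⟨x ∘ f, ⟨x, hB x fun r hr => ?_, fun _ => rfl⟩, fun k hk => ?_⟩
  · rw [hx, LinearMap.comp_apply, Submodule.mkQ_apply, (Submodule.Quotient.mk_eq_zero _).2 hr,
      map_zero]
  · have hk' := LinearMap.congr_fun hh (Pi.single ⟨k, hk⟩ 1)
    simp only [φ, LinearMap.comp_apply, relabel, Fintype.linearCombination_apply_single,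
      one_smul] at hk'
    exact hk'

end Annihilator

/-! ### Output cardinalities -/

/-- The bound on free sets makes `S` maximal and every other input set no larger, so the infimum is
attained at `S`. No structure of `B` is needed. -/
theorem outputCard_eq {ι : Type} [Fintype ι] [DecidableEq ι] {B : Behavior ι} {S : Finset ι}
    {m : ℕ} (hS : IsFree B S) (hcard : S.card + m = Fintype.card ι)
    (hle : ∀ T, IsFree B T → T.card + m ≤ Fintype.card ι) : outputCard B = m := by
  have hmax : IsInputSet B S := ⟨hS, fun T hT hST => by
    have := hle T hT
    exact (Finset.eq_of_subset_of_card_le hST (by omega)).ge⟩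
  have hm : Sᶜ.card = m := by
    rw [Finset.card_compl]
    omega
  refine le_antisymm (Nat.sInf_le ⟨S, hmax, hm⟩) ?_
  obtain ⟨T, hT, hTc⟩ := Nat.sInf_mem (⟨m, S, hmax, hm⟩ :
    {p | ∃ S : Finset ι, IsInputSet B S ∧ Sᶜ.card = p}.Nonempty)
  rw [outputCard, ← hTc, Finset.card_compl]
  have := hle T hT.prop
  omega

theorem IsKernel.outputCard_manifest {ι κ : Type} [Fintype ι] [Fintype κ] [DecidableEq κ]
    {B : Behavior ι} (hB : IsKernel B) (f : κ → ι) (hne : B.Nonempty) :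
    outputCard (manifest f B) = finrank ℝ[X] (annihilator (manifest f B)) := by
  have h₀ : IsFree (manifest f B) ∅ := fun _ =>
    ⟨fun k => hne.some (f k), ⟨_, hne.some_mem, fun _ => rfl⟩, by simp⟩
  obtain ⟨S, -, hS, hcard⟩ := h₀.isIndepMod.exists_card_add_finrank_eq
  exact outputCard_eq (hB.isFree_manifest f hS) hcard fun T hT =>
    hT.isIndepMod.card_add_finrank_le

theorem IsKernel.nonempty {ι : Type} [Fintype ι] {B : Behavior ι} (hB : IsKernel B) :
    B.Nonempty :=
  ⟨0, hB 0 fun r _ => by simp [Fintype.linearCombination_apply]⟩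

/-! ### Regularity -/

section Regular

variable {α γ : Type} [Fintype α] [Fintype γ]

/-- If a plant row and a controller row cancel, the plant row is supported on `γ`, so it vanishes by
`hP`; the sum of the two modules is therefore direct. -/
theorem finrank_annihilator_controlled {P : Behavior (α ⊕ γ)} {C : Behavior γ}
    (hP : IsIndepMod (annihilator P) (Finset.univ.map Function.Embedding.inr)) :
    finrank ℝ[X] (annihilator P) + finrank ℝ[X] (annihilator C) ≤
      finrank ℝ[X] (annihilator (controlled P C)) := by
  classical
  let φ : (annihilator P × annihilator C) →ₗ[ℝ[X]] annihilator (controlled P C) :=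
    LinearMap.codRestrict _
      ((annihilator P).subtype.coprod ((relabel Sum.inr).comp (annihilator C).subtype)) <| by
      rintro ⟨⟨r, hr⟩, ⟨q, hq⟩⟩
      refine mem_annihilator.2 fun x hx => ?_
      simp only [LinearMap.coprod_apply, Submodule.subtype_apply, LinearMap.comp_apply, map_add]
      rw [mem_annihilator.1 hr x hx.1, linearCombination_relabel, zero_add]
      exact mem_annihilator.1 hq _ hx.2
  have hφ : Function.Injective φ := by
    refine (injective_iff_map_eq_zero φ).2 ?_
    rintro ⟨⟨r, hr⟩, ⟨q, hq⟩⟩ h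
    have hsum : r + relabel Sum.inr q = 0 := congrArg Subtype.val h
    have hr0 : r = 0 := by
      refine hP r hr fun j hj => ?_
      have hj' := congrFun hsum j
      rwa [Pi.add_apply, relabel_apply_of_notMem_range q (by simpa using hj), add_zero] at hj'
    have hq0 : q = 0 := by
      rw [hr0, zero_add] at hsum
      funext k
      rw [← relabel_apply (f := (Sum.inr : γ → α ⊕ γ)) Sum.inr_injective q k, hsum]
      rfl
    subst hr0 hq0
    rfl
  have := LinearMap.finrank_le_finrank_of_injective hφ
  rwa [finrank_prod] at this

theorem isRegular_of_manifest_eq_univ [DecidableEq α] [DecidableEq γ] {ι κ : Type} [Fintype ι]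
    [Fintype κ] {A : Behavior ι} {D : Behavior κ} (hA : IsKernel A) (hD : IsKernel D)
    (f : α ⊕ γ → ι) (g : γ → κ) (hfree : manifest Sum.inr (manifest f A) = Set.univ) :
    IsRegular (manifest f A) (manifest g D) := by
  have h₀ : IsFree (manifest f A) (Finset.univ.map Function.Embedding.inr) := by
    intro u
    obtain ⟨x, hx, hxu⟩ := hfree.ge (Set.mem_univ fun c => u (Sum.inr c))
    refine ⟨x, hx, fun j hj => ?_⟩
    obtain ⟨c, -, rfl⟩ := Finset.mem_map.1 hj
    exact (hxu c).symm
  have h₁ : IsFree (manifest g D) ∅ := fun _ =>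
    ⟨fun k => hD.nonempty.some (g k), ⟨_, hD.nonempty.some_mem, fun _ => rfl⟩, by simp⟩
  obtain ⟨S, hS₀, hS, hScard⟩ := h₀.isIndepMod.exists_card_add_finrank_eq
  obtain ⟨T, -, hT, hTcard⟩ := h₁.isIndepMod.exists_card_add_finrank_eq
  have hSfree := hA.isFree_manifest f hS
  have hTfree := hD.isFree_manifest g hT
  -- Solve the controller first, with its inputs `T` prescribed. All of `γ` lies in `S`, so the
  -- plant accepts the resulting `c` along with the prescribed remaining inputs.
  have hU : IsFree (controlled (manifest f A) (manifest g D))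
      (S \ Tᶜ.map Function.Embedding.inr) := by
    intro u
    obtain ⟨c, hc, hcu⟩ := hTfree fun k => u (Sum.inr k)
    obtain ⟨x, hx, hxu⟩ := hSfree (Sum.elim (fun a => u (Sum.inl a)) c)
    have hxc : (fun k => x (Sum.inr k)) = c := funext fun k => hxu _ (hS₀ (by simp))
    refine ⟨x, ⟨hx, hxc ▸ hc⟩, fun j hj => ?_⟩
    obtain ⟨hjS, hjT⟩ := Finset.mem_sdiff.1 hj
    rw [hxu j hjS]
    rcases j with a | k
    · rfl
    · exact hcu k (by simpa using hjT)
  have hle := finrank_annihilator_controlled (C := manifest g D) h₀.isIndepMod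
  rw [IsRegular, hA.outputCard_manifest f hA.nonempty, hD.outputCard_manifest g hD.nonempty]
  -- The rank inequality bounds every free set, so the controlled behavior itself need not be shown
  -- to be determined by its annihilator.
  refine (outputCard_eq hU ?_ fun V hV => ?_).symm
  · have hsub : Tᶜ.map Function.Embedding.inr ⊆ S :=
      (Finset.map_subset_map.2 (Finset.subset_univ _)).trans hS₀
    have h1 := Finset.card_sdiff_add_card_eq_card hsub
    rw [Finset.card_map, Finset.card_compl] at h1
    omega
  · have := hV.isIndepMod.card_add_finrank_le
    omega

end Regular

end Behavioral

theorem mainTheorem5 {L : ℕ} (w c : Fin L → ℕ) (s k : Behavioral.Pair L → ℕ)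
    (P : ∀ i, Behavioral.Behavior ((Fin (w i) ⊕ Behavioral.LocalConn s i) ⊕ Fin (c i)))
    (hP : ∀ i, P i ∈ Behavioral.LinDiff ((Fin (w i) ⊕ Behavioral.LocalConn s i) ⊕ Fin (c i)))
    (K : ∀ i, Behavioral.Behavior (Fin (w i) ⊕ Behavioral.LocalConn k i))
    (hK : ∀ i, K i ∈ Behavioral.LinDiff (Fin (w i) ⊕ Behavioral.LocalConn k i))
    (hfree : Behavioral.manifest Sum.inr (Behavioral.plantNetwork P) = Set.univ)
    (p : Behavioral.Pair L → ℕ) (hp : Behavioral.IsDistributed s p)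
    (C : ∀ i, Behavioral.Behavior (Fin (c i) ⊕ Behavioral.LocalConn p i))
    (hC : ∀ i, C i ∈ Behavioral.LinDiff (Fin (c i) ⊕ Behavioral.LocalConn p i))
    (himpl : Behavioral.Implements P K C) :
    Behavioral.IsRegular
      (Behavioral.manifest (Sum.map Sum.inl id) (Behavioral.plantNetwork P))
      (Behavioral.manifest Sum.inl (Behavioral.network C)) := by
  refine Behavioral.isRegular_of_manifest_eq_univ (Behavioral.isKernel_pullback _ hP)
    (Behavioral.isKernel_pullback _ hC) _ _ (Set.eq_univ_of_forall fun u => ?_)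
  obtain ⟨x, hx, hxu⟩ := hfree.ge (Set.mem_univ u)
  exact ⟨fun v => x (Sum.map Sum.inl id v), ⟨x, hx, fun _ => rfl⟩, hxu⟩
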